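/- For an integer $d\ge 1$ and a real number $\alpha\in(0,\pi)$, let $f_\alpha(d)$ denote the maximal cardinality of a set of points in $\mathbb{R}^d$ such that every angle formed by three distinct points of the set is strictly less than $\alpha$. Then for every $c\in(0,0.02)$ there is a $d_0=d_0(c)$ such that for all $d\ge d_0$ the maximum $f_{\pi/3+c}(d)$ is finite and $$ f_{\pi/3+c}(d) < (1+3.75c)^d. $$ -/

import Mathlib

/-- Every angle formed by three (pairwise distinct) points of `S` is strictly less than `α`. -/
def AnglesLT {d : ℕ} (α : ℝ) (S : Set (EuclideanSpace ℝ (Fin d))) : Prop :=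
  ∀ p ∈ S, ∀ q ∈ S, ∀ r ∈ S, p ≠ q → q ≠ r → p ≠ r → EuclideanGeometry.angle p q r < α

/-- The largest cardinality `f_α(d)` of a set of points of `ℝ^d` all of whose angles are strictly
less than `α`. The value is taken in `ℕ∞`: it is `⊤` exactly if there are such sets that are
infinite or finite ones of unbounded size, and otherwise it is a maximum. -/
noncomputable def maxCardAnglesLT (α : ℝ) (d : ℕ) : ℕ∞ :=
  ⨆ S : {S : Set (EuclideanSpace ℝ (Fin d)) // AnglesLT α S}, S.1.encard

/-! Angles in a triangle sum to π, so all angles at a fixed point p of S lie in [π/3 - 2c, π/3 + c].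
The unit vectors from p to the other points thus have pairwise inner products near one value m. The
entrywise k-th power of the matrix (⟨v_i, v_j⟩ - m)/(1 - m) has unit diagonal, tiny off-diagonal
entries and rank at most C(d+k, k), so tr(A)² ≤ rank(A) tr(A²) bounds its size
(`card_le_of_abs_inner_sub_le`). Taking k proportional to d (`exists_rate`) gives the exponential
bound. -/

/-- Cauchy–Schwarz over the nonzero eigenvalues. -/
theorem Matrix.IsHermitian.trace_sq_le_rank_mul {ι : Type*} [Fintype ι] [DecidableEq ι]
    {A : Matrix ι ι ℝ} (hA : A.IsHermitian) :
    A.trace ^ 2 ≤ A.rank * (A * A).trace := by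
  have h1 : A.trace = ∑ i, hA.eigenvalues i := by
    simpa using hA.trace_eq_sum_eigenvalues
  have h2 : (A * A).trace = ∑ i, hA.eigenvalues i ^ 2 := by
    set D : Matrix ι ι ℝ := Matrix.diagonal hA.eigenvalues with hD
    set U : Matrix ι ι ℝ := (hA.eigenvectorUnitary : Matrix ι ι ℝ) with hU
    have hs : A = U * D * star U := by
      simpa [Unitary.conjStarAlgAut_apply, Function.comp_def] using hA.spectral_theorem
    have hu : star U * U = 1 := Unitary.coe_star_mul_self hA.eigenvectorUnitary
    have h3 : A * A = U * (D * D * star U) := by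
      calc A * A = U * D * (star U * U) * D * star U := by
            conv_lhs => rw [hs]
            simp only [Matrix.mul_assoc]
        _ = _ := by rw [hu]; simp only [Matrix.mul_assoc, Matrix.mul_one]
    rw [h3, Matrix.trace_mul_comm, Matrix.mul_assoc, hu, Matrix.mul_one, hD,
      Matrix.diagonal_mul_diagonal, Matrix.trace_diagonal]
    exact Finset.sum_congr rfl fun i _ => (sq _).symm
  have h3 : A.rank = (Finset.univ.filter fun i => hA.eigenvalues i ≠ 0).card := by
    rw [hA.rank_eq_card_non_zero_eigs, Fintype.card_subtype]
  rw [h1, h2, h3, ← Finset.sum_filter_ne_zero]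
  refine sq_sum_le_card_mul_sum_sq.trans ?_
  gcongr
  exact Finset.filter_subset _ _

/-- The multinomial expansion factors the matrix through the monomials of degree k, indexed by `Sym
κ k`. -/
theorem Matrix.rank_of_dotProduct_pow_le {ι κ : Type*} [Fintype ι] [DecidableEq ι]
    [Fintype κ] [DecidableEq κ] (u w : ι → κ → ℝ) (k : ℕ) :
    (Matrix.of fun i j => (u i ⬝ᵥ w j) ^ k).rank ≤ (Fintype.card κ).multichoose k := by
  have h : (Matrix.of fun i j => (u i ⬝ᵥ w j) ^ k) =
      (Matrix.of fun (i : ι) (s : Sym κ k) =>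
          ((s : Multiset κ).countPerms : ℝ) * ((s : Multiset κ).map (u i)).prod) *
        (Matrix.of fun (s : Sym κ k) (j : ι) => ((s : Multiset κ).map (w j)).prod) := by
    ext i j
    simp only [Matrix.of_apply, Matrix.mul_apply, dotProduct]
    rw [Finset.sum_pow, Finset.sym_univ]
    refine Finset.sum_congr rfl fun s _ => ?_
    rw [Multiset.prod_map_mul, mul_assoc]
    rfl
  rw [h]
  refine (Matrix.rank_mul_le_left _ _).trans ((Matrix.rank_le_card_width _).trans ?_)
  rw [Sym.card_sym_eq_multichoose]

/-- Few unit vectors have all their pairwise inner products near a common value. -/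
theorem card_le_of_abs_inner_sub_le {ι : Type*} [Fintype ι] [DecidableEq ι] {d : ℕ}
    (v : ι → EuclideanSpace ℝ (Fin d)) (hv : ∀ i, ‖v i‖ = 1) {m ε : ℝ} (hm : m < 1)
    (h : ∀ i j, i ≠ j → |inner ℝ (v i) (v j) - m| ≤ ε * (1 - m)) (k : ℕ) :
    (Fintype.card ι : ℝ) ≤ (1 + Fintype.card ι * ε ^ (2 * k)) * (d + k).choose k := by
  have hm' : 0 < 1 - m := by linarith
  -- The extra coordinate `none` absorbs the shift by m, at the cost of one dimension.
  set u : ι → Option (Fin d) → ℝ := fun i a => a.elim (-m / (1 - m)) fun b => v i b / (1 - m)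
    with hu
  set w : ι → Option (Fin d) → ℝ := fun i a => a.elim 1 fun b => v i b with hw
  have huw (i j : ι) : u i ⬝ᵥ w j = (inner ℝ (v i) (v j) - m) / (1 - m) := by
    have : inner ℝ (v i) (v j) = ∑ b, v i b * v j b := by
      simp [PiLp.inner_apply, mul_comm]
    rw [this, sub_div, Finset.sum_div]
    simp only [dotProduct, Fintype.sum_option, hu, hw, Option.elim]
    rw [add_comm, sub_eq_add_neg]
    congr 1
    · exact Finset.sum_congr rfl fun b _ => by ring
    · ring
  set A : Matrix ι ι ℝ := Matrix.of fun i j => (u i ⬝ᵥ w j) ^ k with hAdef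
  have hApply (i j : ι) : A i j = ((inner ℝ (v i) (v j) - m) / (1 - m)) ^ k := by
    simp [hAdef, huw]
  have hA : A.IsHermitian := by
    ext i j
    simp [hApply, real_inner_comm]
  have hdiag (i : ι) : A i i = 1 := by
    rw [hApply, real_inner_self_eq_norm_sq, hv, one_pow, div_self hm'.ne', one_pow]
  have hoff (i j : ι) (hij : i ≠ j) : A i j * A j i ≤ ε ^ (2 * k) := by
    have hs : A j i = A i j := by simpa using hA.apply i j
    rw [hs, ← sq, hApply, ← pow_mul, mul_comm k 2, pow_mul, pow_mul]
    refine pow_le_pow_left₀ (sq_nonneg _) ?_ k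
    rw [← sq_abs, abs_div, abs_of_pos hm']
    exact pow_le_pow_left₀ (by positivity) ((div_le_iff₀ hm').2 (h i j hij)) 2
  have hε : 0 ≤ ε ^ (2 * k) := by rw [pow_mul]; positivity
  have htr : A.trace = Fintype.card ι := by simp [Matrix.trace, hdiag]
  have htr2 : (A * A).trace ≤ Fintype.card ι * (1 + Fintype.card ι * ε ^ (2 * k)) := by
    have : ∀ i, (A * A) i i ≤ 1 + Fintype.card ι * ε ^ (2 * k) := fun i => by
      rw [Matrix.mul_apply]
      have : ∀ j ∈ Finset.univ, A i j * A j i ≤ (if j = i then 1 else 0) + ε ^ (2 * k) := by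
        intro j _
        split_ifs with hj
        · subst hj; simp [hdiag, hε]
        · simpa using hoff i j (Ne.symm hj)
      refine (Finset.sum_le_sum this).trans ?_
      simp [Finset.sum_add_distrib]
    refine (Finset.sum_le_sum fun i _ => this i).trans ?_
    simp [mul_add]
  have hrank : A.rank ≤ (d + k).choose k := by
    refine (Matrix.rank_of_dotProduct_pow_le u w k).trans ?_
    rw [Nat.multichoose_eq]
    simp [Fintype.card_option, add_right_comm]
  have key := hA.trace_sq_le_rank_mul
  rw [htr] at key
  rcases (Nat.cast_nonneg (α := ℝ) (Fintype.card ι)).eq_or_lt with h0 | h0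
  · rw [← h0]; positivity
  refine le_of_mul_le_mul_left ?_ h0
  calc (Fintype.card ι : ℝ) * Fintype.card ι = (Fintype.card ι : ℝ) ^ 2 := (sq _).symm
    _ ≤ A.rank * (A * A).trace := key
    _ ≤ (d + k).choose k * (Fintype.card ι * (1 + Fintype.card ι * ε ^ (2 * k))) := by
      refine mul_le_mul (by exact_mod_cast hrank) htr2 ?_ (by positivity)
      exact (Finset.sum_nonneg fun i _ => by
        rw [Matrix.diag_apply, Matrix.mul_apply]
        refine Finset.sum_nonneg fun j _ => ?_
        have hs : A j i = A i j := by simpa using hA.apply i j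
        rw [hs]; exact mul_self_nonneg _)
    _ = _ := by ring

/-! ### Choice of the exponent k -/

theorem Nat.choose_add_le_exp {d k : ℕ} {t : ℝ} (ht : 0 < t) :
    ((d + k).choose k : ℝ) ≤ Real.exp ((d + k) * Real.log (1 + t) - k * Real.log t) := by
  have h : ((d + k).choose k : ℝ) * t ^ k ≤ (1 + t) ^ (d + k) := by
    rw [add_comm 1 t, add_pow]
    refine le_trans ?_ (Finset.single_le_sum
      (f := fun i => t ^ i * 1 ^ (d + k - i) * ((d + k).choose i : ℝ))
      (fun i _ => by positivity) (Finset.mem_range.2 (show k < d + k + 1 by omega)))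
    simp [mul_comm]
  rw [Real.exp_sub, le_div_iff₀ (Real.exp_pos _), mul_comm (k : ℝ), Real.exp_mul,
    Real.exp_log ht, Real.rpow_natCast, mul_comm (_ + _ : ℝ), Real.exp_mul,
    Real.exp_log (by linarith)]
  exact_mod_cast h

/-- Here t plays the role of k/d: the third condition makes the off-diagonal terms negligible, the
last keeps the rank bound exponentially below exp(3.5cd). -/
theorem exists_rate {c : ℝ} (hc0 : 0 < c) (hc : c < 0.02) :
    ∃ t : ℝ, 0 < t ∧ t < 1 ∧ 3.5 * c ≤ 2 * t * Real.log (3 / (8 * c)) ∧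
      (1 + t) * Real.log (1 + t) - t * Real.log t < 3.5 * c := by
  set l := Real.log (3 / (8 * c)) with hl
  have hl2 : 2.75 ≤ l := by
    rw [hl, Real.le_log_iff_exp_le (by positivity)]
    have h1 : (18.75 : ℝ) ≤ 3 / (8 * c) := by
      rw [le_div_iff₀ (by positivity)]; linarith
    refine le_trans ?_ h1
    have he := Real.exp_one_lt_d9
    have h2 : Real.exp 2.75 ^ 4 = Real.exp 1 ^ 11 := by
      rw [← Real.exp_nat_mul, ← Real.exp_nat_mul]; norm_num
    refine le_of_pow_le_pow_left₀ (n := 4) (by norm_num) (by norm_num) ?_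
    rw [h2]
    refine (pow_le_pow_left₀ (Real.exp_pos 1).le he.le 11).trans ?_
    norm_num
  have hl0 : 0 < l := by linarith
  -- The least t allowed by the third condition.
  set t := 1.75 * c / l with ht
  have ht0 : 0 < t := by positivity
  have htl : t * l = 1.75 * c := by rw [ht]; field_simp
  have ht1 : t ≤ 0.02 := by nlinarith
  refine ⟨t, ht0, by linarith, by linarith, ?_⟩
  have hlog1 : Real.log (1 + t) ≤ t := by
    have := Real.log_le_sub_one_of_pos (show 0 < 1 + t by linarith); linarith
  have hlog2 : -Real.log t = l + Real.log (32 / 21) + Real.log l := by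
    rw [hl, ← Real.log_mul (by positivity) (by norm_num), ← hl, ← Real.log_mul (by positivity)
      hl0.ne', ← Real.log_inv]
    congr 1
    rw [ht]; field_simp; norm_num
  have h3 : Real.log (32 / 21) ≤ 0.53 := by
    have := Real.log_le_sub_one_of_pos (show (0 : ℝ) < 32 / 21 by norm_num); linarith
  -- Tangent line of log at 2.
  have h4 : Real.log l ≤ l / 2 - 0.3 := by
    have h5 := Real.log_le_sub_one_of_pos (show 0 < l / 2 by linarith)
    rw [Real.log_div hl0.ne' (by norm_num)] at h5
    have := Real.log_two_lt_d9
    linarith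
  have h6 : (1 + t) * Real.log (1 + t) ≤ (1 + t) * t := by gcongr
  have h7 : -Real.log t ≤ 1.5 * l + 0.23 := by linarith
  have h8 : t * -Real.log t ≤ t * (1.5 * l + 0.23) := by gcongr
  nlinarith

theorem eventually_exists_choose_lt {c : ℝ} (hc0 : 0 < c) (hc : c < 0.02) :
    ∀ᶠ d : ℕ in Filter.atTop, ∃ k : ℕ,
      3 * ((d + k).choose k : ℝ) < Real.exp (3.5 * c * d) ∧
      Real.exp (3.5 * c * d) * (8 * c / 3) ^ (2 * k) ≤ 1 := by
  obtain ⟨t, ht0, ht1, hk, hg⟩ := exists_rate hc0 hc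
  set g := (1 + t) * Real.log (1 + t) - t * Real.log t with hgdef
  have hlim : Filter.Tendsto (fun d : ℕ => (3.5 * c - g) * (d : ℝ)) Filter.atTop Filter.atTop :=
    tendsto_natCast_atTop_atTop.const_mul_atTop (by linarith)
  filter_upwards [hlim.eventually_gt_atTop (Real.log 3 + (Real.log (1 + t) - Real.log t))]
    with d hd
  have hk1 : t * d ≤ ⌈t * d⌉₊ := Nat.le_ceil _
  have hk2 : (⌈t * d⌉₊ : ℝ) < t * d + 1 := Nat.ceil_lt_add_one (by positivity)
  refine ⟨⌈t * d⌉₊, ?_, ?_⟩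
  · have hpos : 0 < Real.log (1 + t) - Real.log t := by
      have := Real.log_pos (show 1 < 1 + t by linarith)
      have := Real.log_neg ht0 ht1
      linarith
    calc 3 * ((d + ⌈t * d⌉₊).choose ⌈t * d⌉₊ : ℝ)
        ≤ Real.exp (Real.log 3) *
          Real.exp ((d + ⌈t * d⌉₊) * Real.log (1 + t) - ⌈t * d⌉₊ * Real.log t) := by
            rw [Real.exp_log (by norm_num)]
            gcongr
            exact Nat.choose_add_le_exp ht0
      _ < _ := by
        rw [← Real.exp_add, Real.exp_lt_exp]
        nlinarith
  · have hc3 : 8 * c / 3 = Real.exp (-Real.log (3 / (8 * c))) := by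
      rw [← Real.log_inv, Real.exp_log (by positivity)]; field_simp
    rw [hc3, ← Real.exp_nat_mul, ← Real.exp_add, Real.exp_le_one_iff]
    have hl : 0 < Real.log (3 / (8 * c)) := by
      apply Real.log_pos; rw [lt_div_iff₀ (by positivity)]; linarith
    push_cast
    nlinarith [mul_le_mul_of_nonneg_right hk1 hl.le,
      mul_le_mul_of_nonneg_right hk (Nat.cast_nonneg (α := ℝ) d)]

/-! ### Geometry of the angles -/

/-- To first order cos θ - 1/2 ranges over [-(√3/2)c, √3c], with midpoint (√3/4)c ≈ 0.43c and
half-width about 1.3c, just under (8c/3)/2. -/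
theorem abs_cos_sub_le_of_near_pi_div_three {c θ : ℝ} (hc0 : 0 < c) (hc : c < 0.02)
    (h1 : Real.pi / 3 - 2 * c ≤ θ) (h2 : θ ≤ Real.pi / 3 + c) :
    |Real.cos θ - (0.5 + 0.43 * c)| ≤ 8 * c / 3 * (1 - (0.5 + 0.43 * c)) := by
  have hπ := Real.pi_gt_three
  have hs : √3 < 1.7321 := by
    rw [Real.sqrt_lt' (by norm_num)]; norm_num
  have hs0 : 0 ≤ √3 := Real.sqrt_nonneg _
  have hu : Real.cos θ ≤ 0.5 + 1.7321 * c := by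
    refine (Real.cos_le_cos_of_nonneg_of_le_pi (by linarith) (by linarith) h1).trans ?_
    rw [Real.cos_sub, Real.cos_pi_div_three, Real.sin_pi_div_three]
    have h3 := Real.cos_le_one (2 * c)
    have h4 := Real.sin_le (show 0 ≤ 2 * c by linarith)
    have h5 : √3 / 2 * Real.sin (2 * c) ≤ √3 / 2 * (2 * c) := by gcongr
    nlinarith
  have hl : 0.5 - 0.8711 * c ≤ Real.cos θ := by
    refine le_trans ?_ (Real.cos_le_cos_of_nonneg_of_le_pi (by linarith) (by linarith) h2)
    rw [Real.cos_add, Real.cos_pi_div_three, Real.sin_pi_div_three]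
    have h3 := Real.one_sub_sq_div_two_le_cos (x := c)
    have h4 := Real.sin_le hc0.le
    have h5 : √3 / 2 * Real.sin c ≤ √3 / 2 * c := by gcongr
    nlinarith
  rw [abs_le]
  constructor <;> nlinarith

theorem AnglesLT.pi_div_three_sub_le_angle {d : ℕ} {c : ℝ} {S : Set (EuclideanSpace ℝ (Fin d))}
    (hS : AnglesLT (Real.pi / 3 + c) S) {p q r : EuclideanSpace ℝ (Fin d)} (hp : p ∈ S)
    (hq : q ∈ S) (hr : r ∈ S) (hpq : p ≠ q) (hqr : q ≠ r) (hpr : p ≠ r) :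
    Real.pi / 3 - 2 * c ≤ EuclideanGeometry.angle p q r := by
  have h := EuclideanGeometry.angle_add_angle_add_angle_eq_pi r hpq.symm
  have h1 := hS q hq r hr p hp hqr hpr.symm hpq.symm
  have h2 := hS r hr p hp q hq hpr.symm hpq hqr.symm
  linarith

theorem AnglesLT.card_le {d : ℕ} {c : ℝ} (hc0 : 0 < c) (hc : c < 0.02)
    {S : Set (EuclideanSpace ℝ (Fin d))} (hS : AnglesLT (Real.pi / 3 + c) S)
    (T : Finset (EuclideanSpace ℝ (Fin d))) {p : EuclideanSpace ℝ (Fin d)} (hp : p ∈ S)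
    (hT : ↑T ⊆ S \ {p}) (k : ℕ) :
    (T.card : ℝ) ≤ (1 + T.card * (8 * c / 3) ^ (2 * k)) * (d + k).choose k := by
  classical
  have hne (q : T) : (q : EuclideanSpace ℝ (Fin d)) ≠ p := fun h => (hT q.2).2 h
  have hnorm (q : T) : ‖(q : EuclideanSpace ℝ (Fin d)) - p‖ ≠ 0 :=
    norm_ne_zero_iff.2 (sub_ne_zero.2 (hne q))
  have := card_le_of_abs_inner_sub_le
    (fun q : T => ‖(q : EuclideanSpace ℝ (Fin d)) - p‖⁻¹ • ((q : EuclideanSpace ℝ (Fin d)) - p))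
    (fun q => by rw [norm_smul, norm_inv, norm_norm, inv_mul_cancel₀ (hnorm q)])
    (m := 0.5 + 0.43 * c) (ε := 8 * c / 3) (by linarith)
    (fun q r hqr => by
      have hqr' : (q : EuclideanSpace ℝ (Fin d)) ≠ r := fun h => hqr (Subtype.ext h)
      have h := abs_cos_sub_le_of_near_pi_div_three hc0 hc
        (hS.pi_div_three_sub_le_angle (hT q.2).1 hp (hT r.2).1 (hne q) (hne r).symm hqr')
        (hS q (hT q.2).1 p hp r (hT r.2).1 (hne q) (hne r).symm hqr').le
      rw [EuclideanGeometry.angle, InnerProductGeometry.cos_angle] at h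
      convert h using 3
      rw [real_inner_smul_left, real_inner_smul_right, vsub_eq_sub, vsub_eq_sub]
      have := hnorm q
      have := hnorm r
      field_simp) k
  simpa using this

theorem Real.exp_mul_le_one_add_pow {c : ℝ} (hc0 : 0 < c) (hc : c < 0.02) (d : ℕ) :
    Real.exp (3.5 * c * d) ≤ (1 + 3.75 * c) ^ d := by
  rw [mul_comm, Real.exp_nat_mul]
  refine pow_le_pow_left₀ (Real.exp_pos _).le ?_ d
  have h := Real.abs_exp_sub_one_sub_id_le (x := 3.5 * c)
    (by rw [abs_of_pos (by linarith)]; linarith)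
  have := (abs_le.1 h).2
  nlinarith

theorem theorem2 (c : ℝ) (hc : c ∈ Set.Ioo (0 : ℝ) 0.02) :
    ∀ᶠ d : ℕ in Filter.atTop,
      ∃ N : ℕ, maxCardAnglesLT (Real.pi / 3 + c) d = (N : ℕ∞) ∧ (N : ℝ) < (1 + 3.75 * c) ^ d := by
  obtain ⟨hc0, hc1⟩ := hc
  filter_upwards [eventually_exists_choose_lt hc0 hc1] with d ⟨k, hk1, hk2⟩
  set x := Real.exp (3.5 * c * d) with hx
  have hx0 : 0 < x := Real.exp_pos _
  obtain ⟨n, hn⟩ : ∃ n, ⌈x⌉₊ = n + 1 := Nat.exists_eq_succ_of_ne_zero (Nat.ceil_pos.2 hx0).ne'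
  have hn1 : (n : ℝ) < x := Nat.lt_ceil.1 (by omega)
  have hn2 : x ≤ n + 1 := by
    have := Nat.le_ceil x
    rw [hn] at this
    exact_mod_cast this
  have hsup : maxCardAnglesLT (Real.pi / 3 + c) d ≤ n := by
    refine iSup_le fun ⟨S, hS⟩ => ?_
    by_contra! hlt
    have hlt' : ((n + 1 : ℕ) : ℕ∞) ≤ S.encard := by
      rw [Nat.cast_add, Nat.cast_one]; exact Order.add_one_le_of_lt hlt
    obtain ⟨U, hUS, hU⟩ := Set.exists_subset_encard_eq hlt'
    lift U to Finset (EuclideanSpace ℝ (Fin d)) using Set.finite_of_encard_eq_coe hU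
    rw [Set.encard_coe_eq_coe_finsetCard, Nat.cast_inj] at hU
    classical
    obtain ⟨p, hp⟩ : U.Nonempty := Finset.card_pos.1 (by omega)
    have hT : (↑(U.erase p) : Set (EuclideanSpace ℝ (Fin d))) ⊆ S \ {p} := by
      rw [Finset.coe_erase]; exact Set.sdiff_subset_sdiff_left hUS
    have hcard := hS.card_le hc0 hc1 (U.erase p) (hUS hp) hT k
    rw [Finset.card_erase_of_mem hp, hU, Nat.add_sub_cancel] at hcard
    -- With C = C(d+k, k) ≥ 1, the bound n ≤ 2C contradicts n ≥ x - 1 > 3C - 1; hence the factor 3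
    -- in `hk1`.
    have hC : (1 : ℝ) ≤ (d + k).choose k := by
      exact_mod_cast Nat.choose_pos (Nat.le_add_left k d)
    have h3 : (n : ℝ) * (8 * c / 3) ^ (2 * k) ≤ 1 :=
      (mul_le_mul_of_nonneg_right hn1.le (by positivity)).trans hk2
    have h4 : (1 + (n : ℝ) * (8 * c / 3) ^ (2 * k)) * (d + k).choose k ≤
        2 * (d + k).choose k := by gcongr; linarith
    linarith
  obtain ⟨N, hN⟩ := ENat.ne_top_iff_exists.1 (ne_top_of_le_ne_top (ENat.natCast_ne_top n) hsup)
  refine ⟨N, hN.symm, ?_⟩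
  rw [← hN, Nat.cast_le] at hsup
  calc (N : ℝ) ≤ n := by exact_mod_cast hsup
    _ < x := hn1
    _ ≤ _ := Real.exp_mul_le_one_add_pow hc0 hc1 d
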